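/- Let $q\ge 2$ be an integer and $M=\lfloor q/2\rfloor$. For $x\in\mathbb Z/q\mathbb Z$, represented by an integer in $\{0,\dots,q-1\}$, let $\mathrm{wt}_L(x)=\min\{x,q-x\}$ be its Lee weight; the Lee weight of a vector in $(\mathbb Z/q\mathbb Z)^n$ is the sum of the Lee weights of its coordinates. Let $F_L(n,w,q)$ and $V_L(n,w,q)$ be the numbers of $\mathbf v\in(\mathbb Z/q\mathbb Z)^n$ of Lee weight exactly $w$ and at most $w$, respectively. Let $t(n)$ be a sequence of non-negative integers with $\lim_{n\to\infty}t(n)/n=T$, where $0\le T<M$. 1. Let $q$ be odd and $f(x)=1+2\sum_{i=1}^M x^i$. If $T>0$, then the equation $2\sum_{i=1}^M(i-T)x^i=T$ has a unique positive real solution $\rho$, it satisfies $$f(\rho)=\frac{M(\rho+1)+1}{(1-\rho)(M-T)+1},$$ and $$\lim_{n\to\infty}\frac1n\log_q F_L(n,t(n),q)=\log_q f(\rho)-T\log_q\rho .$$ If moreover $T<\frac{M(M+1)}{2M+1}$, then also $$\lim_{n\to\infty}\frac1n\log_q V_L(n,t(n),q)=\log_q f(\rho)-T\log_q\rho .$$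 2. Let $q$ be even and $g(x)=1+2\sum_{i=1}^{M-1}x^i+x^M$. If $T>0$, then the equation $2\sum_{i=1}^{M-1}(i-T)x^i+(M-T)x^M=T$ has a unique positive real solution $\rho'$, it satisfies $$\bigl((1-\rho')(M-T)+1\bigr)\,g(\rho')=M(\rho'+1)+1-\rho'^{M},$$ and $$\lim_{n\to\infty}\frac1n\log_q F_L(n,t(n),q)=\log_q g(\rho')-T\log_q\rho' .$$ If moreover $T<\frac M2$, then also $$\lim_{n\to\infty}\frac1n\log_q V_L(n,t(n),q)=\log_q g(\rho')-T\log_q\rho' .$$ 3. If $T=0$ (the root degenerates to $0$), then for $q$ odd as well as for $q$ even both limits, for $F_L$ and for $V_L$, are equal to $0$. -/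

import Mathlib

open Filter Topology

/-- The Lee weight `min {x, m - x}` of `x ∈ ℤ/mℤ`, where `x` is represented in `{0, …, m - 1}`. -/
def leeWeight {m : ℕ} (x : ZMod m) : ℕ := min x.val (m - x.val)

/-- The Lee weight of a vector: the sum of the Lee weights of its coordinates. -/
def leeWeightVec {n m : ℕ} (v : Fin n → ZMod m) : ℕ := ∑ i, leeWeight (v i)

/-- The Lee sphere of radius `w` in `(ℤ/mℤ)^n`. -/
def leeSphere (n w m : ℕ) : Set (Fin n → ZMod m) := {v | leeWeightVec v = w}

/-- The Lee ball of radius `w` in `(ℤ/mℤ)^n`. -/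
def leeBall (n w m : ℕ) : Set (Fin n → ZMod m) := {v | leeWeightVec v ≤ w}

/-- `F_L(n, w, m)`, the size of the Lee sphere. -/
noncomputable def leeSphereSize (n w m : ℕ) : ℕ := (leeSphere n w m).ncard

/-- `V_L(n, w, m)`, the size of the Lee ball. -/
noncomputable def leeBallSize (n w m : ℕ) : ℕ := (leeBall n w m).ncard

/-- `f(x) = 1 + 2 ∑_{i=1}^M x^i`, used for odd modulus `2M + 1`. -/
noncomputable def leeGenOdd (M : ℕ) (x : ℝ) : ℝ :=
  1 + 2 * ∑ i ∈ Finset.Icc 1 M, x ^ i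

/-- `g(x) = 1 + 2 ∑_{i=1}^{M-1} x^i + x^M`, used for even modulus `2M`, `M ≥ 1`. -/
noncomputable def leeGenEven (M : ℕ) (x : ℝ) : ℝ :=
  1 + 2 * ∑ i ∈ Finset.Icc 1 (M - 1), x ^ i + x ^ M

/-- The saddle point equation `2 ∑_{i=1}^M (i - T) x^i = T` of the odd case. -/
def IsLeeSaddleOdd (M : ℕ) (T x : ℝ) : Prop :=
  2 * ∑ i ∈ Finset.Icc 1 M, ((i : ℝ) - T) * x ^ i = T

/-- The saddle point equation `2 ∑_{i=1}^{M-1} (i - T) x^i + (M - T) x^M = T` of the even case. -/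
def IsLeeSaddleEven (M : ℕ) (T x : ℝ) : Prop :=
  2 * ∑ i ∈ Finset.Icc 1 (M - 1), ((i : ℝ) - T) * x ^ i + ((M : ℝ) - T) * x ^ M = T

/-!
The Lee weight enters only through three facts: it takes every value `0, …, M` on the letters and
no other, it vanishes at a single letter, and its enumerator `∑ₐ x ^ ℓ(a)` is `f` or `g`. The growth
rates are therefore computed for words over any finite alphabet with an integer letter weight `ℓ`.

Upper bounds come from `∑ᵥ x ^ wt(v) = (∑ₐ x ^ ℓ(a)) ^ n`, where all terms are positive: the sphere
satisfies `F x ^ t ≤ (∑ₐ x ^ ℓ(a)) ^ n` for every `x > 0`, and the ball does for `x ≤ 1`. The saddle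
point lies below `1` exactly when `T` lies below the mean letter weight, which is the extra
hypothesis on the ball. For `T = 0` the same bound with `x` near `0` suffices.

For the lower bound, draw the letters independently with probability proportional to `ρ ^ ℓ(a)`.
The saddle point equation says that a letter has mean weight `T`, so by Chebyshev's inequality at
least half of the mass lies on words of weight within `C √n` of `n T`, and by pigeonhole some single
weight `w` in this window already has `F(w) ρ ^ w` large (`exists_heavy_weight`). That `w` need not
be `t n`; but since `0 < T < M`, a block of `k = o(n)` extra letters can absorb both the `O(√n)` and
the `|t n - n T| = o(n)` discrepancy, and appending a fixed such block embeds the heavy sphere of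
length `n - k` into the sphere of radius `t n` (`exists_le_log_sphereCount`).

Existence of the saddle point is the intermediate value theorem, and uniqueness holds because
`x ^ (-T) ∑ₐ (ℓ(a) - T) x ^ ℓ(a)` is strictly increasing (`saddleFun_lt`). The closed forms of `f(ρ)`
and `g(ρ)` follow by telescoping the geometric sums.
-/

/-! ### Words over a weighted alphabet -/

variable {A : Type*}

/-- The weight of a word: the sum of the weights `ℓ` of its letters. -/
def wordWeight (ℓ : A → ℕ) {n : ℕ} (v : Fin n → A) : ℕ := ∑ i, ℓ (v i)

theorem exists_wordWeight_eq {ℓ : A → ℕ} {M : ℕ} (hsurj : ∀ j ≤ M, ∃ a, ℓ a = j) (n : ℕ) :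
    ∀ s ≤ M * n, ∃ u : Fin n → A, wordWeight ℓ u = s := by
  induction n with
  | zero => intro s hs; exact ⟨Fin.elim0, by simp [wordWeight]; omega⟩
  | succ n ih =>
    intro s hs
    -- the first letter takes as much of the weight as it can
    obtain ⟨a, ha⟩ := hsurj (min M s) (min_le_left _ _)
    obtain ⟨u, hu⟩ := ih (s - min M s) (by rw [Nat.mul_succ] at hs; omega)
    refine ⟨Fin.cons a u, ?_⟩
    unfold wordWeight at hu ⊢
    rw [Fin.sum_univ_succ]
    simp only [Fin.cons_zero, Fin.cons_succ, hu, ha]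
    omega

variable [Fintype A]

/-- The number of words of length `n` and weight exactly `w`. -/
noncomputable def sphereCount (ℓ : A → ℕ) (n w : ℕ) : ℕ :=
  (Finset.univ.filter fun v : Fin n → A => wordWeight ℓ v = w).card

/-- The number of words of length `n` and weight at most `w`. -/
noncomputable def ballCount (ℓ : A → ℕ) (n w : ℕ) : ℕ :=
  (Finset.univ.filter fun v : Fin n → A => wordWeight ℓ v ≤ w).card

/-- The weight enumerator `∑ₐ x ^ ℓ(a)` of the alphabet. -/
noncomputable def enumerator (ℓ : A → ℕ) (x : ℝ) : ℝ := ∑ a, x ^ ℓ a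

/-- The function `∑ₐ (ℓ(a) - T) x ^ ℓ(a)`, whose positive zero is the saddle point. -/
noncomputable def saddleFun (ℓ : A → ℕ) (T x : ℝ) : ℝ := ∑ a, ((ℓ a : ℝ) - T) * x ^ ℓ a

/-! ### Counting words by weight -/

theorem sum_pow_wordWeight (ℓ : A → ℕ) (n : ℕ) (x : ℝ) :
    ∑ v : Fin n → A, x ^ wordWeight ℓ v = enumerator ℓ x ^ n := by
  simp only [wordWeight, enumerator, Fintype.sum_pow, Finset.prod_pow_eq_pow_sum]

theorem enumerator_pos [Nonempty A] (ℓ : A → ℕ) {x : ℝ} (hx : 0 < x) : 0 < enumerator ℓ x :=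
  Finset.sum_pos (fun _ _ => pow_pos hx _) Finset.univ_nonempty

theorem sphereCount_le_ballCount (ℓ : A → ℕ) (n w : ℕ) : sphereCount ℓ n w ≤ ballCount ℓ n w :=
  Finset.card_le_card fun v hv => by
    simp only [Finset.mem_filter, Finset.mem_univ, true_and] at hv ⊢
    exact hv.le

theorem sphereCount_mul_pow_le (ℓ : A → ℕ) (n w : ℕ) {x : ℝ} (hx : 0 < x) :
    (sphereCount ℓ n w : ℝ) * x ^ w ≤ enumerator ℓ x ^ n := by
  rw [← sum_pow_wordWeight, sphereCount, ← nsmul_eq_mul, ← Finset.sum_const]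
  calc _ = ∑ v : Fin n → A with wordWeight ℓ v = w, x ^ wordWeight ℓ v :=
        Finset.sum_congr rfl fun v hv => by rw [(Finset.mem_filter.1 hv).2]
    _ ≤ _ := Finset.sum_le_sum_of_subset_of_nonneg (Finset.filter_subset _ _)
        fun v _ _ => (pow_pos hx _).le

theorem ballCount_mul_pow_le (ℓ : A → ℕ) (n w : ℕ) {x : ℝ} (hx : 0 < x) (hx1 : x ≤ 1) :
    (ballCount ℓ n w : ℝ) * x ^ w ≤ enumerator ℓ x ^ n := by
  rw [← sum_pow_wordWeight, ballCount, ← nsmul_eq_mul, ← Finset.sum_const]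
  calc _ ≤ ∑ v : Fin n → A with wordWeight ℓ v ≤ w, x ^ wordWeight ℓ v :=
        Finset.sum_le_sum fun v hv =>
          pow_le_pow_of_le_one hx.le hx1 (Finset.mem_filter.1 hv).2
    _ ≤ _ := Finset.sum_le_sum_of_subset_of_nonneg (Finset.filter_subset _ _)
        fun v _ _ => (pow_pos hx _).le

theorem sphereCount_pos {ℓ : A → ℕ} {M : ℕ} (hsurj : ∀ j ≤ M, ∃ a, ℓ a = j) {n s : ℕ}
    (hs : s ≤ M * n) : 0 < sphereCount ℓ n s := by
  obtain ⟨u, hu⟩ := exists_wordWeight_eq hsurj n s hs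
  exact Finset.card_pos.2 ⟨u, by simpa using hu⟩

/-- Padding with one fixed word of length `k` and weight `s` embeds a sphere into a sphere in the
longer space. -/
theorem sphereCount_le_add {ℓ : A → ℕ} {M : ℕ} (hsurj : ∀ j ≤ M, ∃ a, ℓ a = j) {k s : ℕ}
    (hs : s ≤ M * k) (m w : ℕ) : sphereCount ℓ m w ≤ sphereCount ℓ (m + k) (w + s) := by
  obtain ⟨u, hu⟩ := exists_wordWeight_eq hsurj k s hs
  refine Finset.card_le_card_of_injOn (fun v => Fin.append v u) ?_ ?_
  · intro v hv
    simp only [Finset.coe_filter, Finset.mem_univ, true_and, Set.mem_ofPred_eq] at hv ⊢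
    unfold wordWeight at hv hu ⊢
    simp [Fin.sum_univ_add, hv, hu]
  · intro v _ v' _ h
    funext i
    simpa using congrFun h (Fin.castAdd k i)

/-! ### Concentration under the tilted measure -/

theorem sum_pow_mul_deviation {ℓ : A → ℕ} {T x : ℝ} (h : saddleFun ℓ T x = 0) (n : ℕ) :
    ∑ v : Fin n → A, x ^ wordWeight ℓ v * ((wordWeight ℓ v : ℝ) - n * T) = 0 := by
  induction n with
  | zero => simp [wordWeight]
  | succ n ih =>
    rw [← (Fin.consEquiv fun _ => A).sum_comp, Fintype.sum_prod_type]
    have key : ∀ a : A, ∑ v : Fin n → A, (x ^ wordWeight ℓ (Fin.consEquiv (fun _ => A) (a, v)) *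
        ((wordWeight ℓ (Fin.consEquiv (fun _ => A) (a, v)) : ℝ) - (n + 1 : ℕ) * T)) =
        ((ℓ a : ℝ) - T) * x ^ ℓ a * enumerator ℓ x ^ n := by
      intro a
      calc _ = ∑ v : Fin n → A, (((ℓ a : ℝ) - T) * x ^ ℓ a * x ^ wordWeight ℓ v +
            x ^ ℓ a * (x ^ wordWeight ℓ v * ((wordWeight ℓ v : ℝ) - n * T))) := by
            refine Finset.sum_congr rfl fun v _ => ?_
            have : wordWeight ℓ (Fin.consEquiv (fun _ => A) (a, v)) = ℓ a + wordWeight ℓ v := by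
              simp [wordWeight, Fin.sum_univ_succ, Fin.consEquiv]
            rw [this, pow_add]; push_cast; ring
        _ = _ := by
            rw [Finset.sum_add_distrib, ← Finset.mul_sum, ← Finset.mul_sum, ih,
              sum_pow_wordWeight]; ring
    simp_rw [key]
    rw [← Finset.sum_mul]
    unfold saddleFun at h
    rw [h, zero_mul]

/-- At a saddle point the weight of a random word, drawn with probability proportional to
`x ^ wordWeight`, has mean `n T` and a variance linear in `n`. -/
theorem sum_pow_mul_deviation_sq {ℓ : A → ℕ} {T x : ℝ} (h : saddleFun ℓ T x = 0) (n : ℕ) :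
    enumerator ℓ x *
      ∑ v : Fin n → A, x ^ wordWeight ℓ v * ((wordWeight ℓ v : ℝ) - n * T) ^ 2 =
      n * (∑ a, ((ℓ a : ℝ) - T) ^ 2 * x ^ ℓ a) * enumerator ℓ x ^ n := by
  induction n with
  | zero => simp [wordWeight]
  | succ n ih =>
    rw [← (Fin.consEquiv fun _ => A).sum_comp, Fintype.sum_prod_type]
    set S := ∑ v : Fin n → A, x ^ wordWeight ℓ v * ((wordWeight ℓ v : ℝ) - n * T) ^ 2 with hS
    have key : ∀ a : A, ∑ v : Fin n → A, (x ^ wordWeight ℓ (Fin.consEquiv (fun _ => A) (a, v)) *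
        ((wordWeight ℓ (Fin.consEquiv (fun _ => A) (a, v)) : ℝ) - (n + 1 : ℕ) * T) ^ 2) =
        ((ℓ a : ℝ) - T) ^ 2 * x ^ ℓ a * enumerator ℓ x ^ n + x ^ ℓ a * S := by
      intro a
      calc _ = ∑ v : Fin n → A, (((ℓ a : ℝ) - T) ^ 2 * x ^ ℓ a * x ^ wordWeight ℓ v +
            2 * ((ℓ a : ℝ) - T) * x ^ ℓ a *
              (x ^ wordWeight ℓ v * ((wordWeight ℓ v : ℝ) - n * T)) +
            x ^ ℓ a * (x ^ wordWeight ℓ v * ((wordWeight ℓ v : ℝ) - n * T) ^ 2)) := by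
            refine Finset.sum_congr rfl fun v _ => ?_
            have : wordWeight ℓ (Fin.consEquiv (fun _ => A) (a, v)) = ℓ a + wordWeight ℓ v := by
              simp [wordWeight, Fin.sum_univ_succ, Fin.consEquiv]
            rw [this, pow_add]; push_cast; ring
        _ = _ := by
            rw [Finset.sum_add_distrib, Finset.sum_add_distrib, ← Finset.mul_sum,
              ← Finset.mul_sum, ← Finset.mul_sum, sum_pow_mul_deviation h,
              sum_pow_wordWeight]; ring
    simp_rw [key]
    rw [Finset.sum_add_distrib, ← Finset.sum_mul, ← Finset.sum_mul]
    change enumerator ℓ x * (_ + enumerator ℓ x * S) = _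
    rw [mul_add, ih]
    push_cast; ring

/-- Chebyshev's inequality and the pigeonhole principle: at a saddle point, some weight within
`C √n` of `n T` carries a fraction `1 / (2 (M n + 1))` of the total mass. -/
theorem exists_heavy_weight [Nonempty A] {ℓ : A → ℕ} {M : ℕ} (hle : ∀ a, ℓ a ≤ M) {T x : ℝ}
    (hx : 0 < x) (h : saddleFun ℓ T x = 0) :
    ∃ C : ℝ, 0 ≤ C ∧ ∀ n : ℕ, ∃ w : ℕ, |(w : ℝ) - n * T| ≤ C * √n ∧
      enumerator ℓ x ^ n ≤ 2 * (M * n + 1) * (sphereCount ℓ n w * x ^ w) := by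
  have hZ := enumerator_pos ℓ hx
  set Z := enumerator ℓ x
  set σ := ∑ a, ((ℓ a : ℝ) - T) ^ 2 * x ^ ℓ a with hσ
  have hσ0 : 0 ≤ σ := Finset.sum_nonneg fun a _ => by positivity
  refine ⟨√(2 * σ / Z), Real.sqrt_nonneg _, fun n => ?_⟩
  have hvar := sum_pow_mul_deviation_sq h n
  set p : (Fin n → A) → ℝ := fun v => x ^ wordWeight ℓ v with hp
  have hp0 : ∀ v, 0 < p v := fun v => pow_pos hx _
  set d : (Fin n → A) → ℝ := fun v => (wordWeight ℓ v : ℝ) - n * T with hd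
  have htot : ∑ v, p v = Z ^ n := sum_pow_wordWeight ℓ n x
  have hvar' : Z * ∑ v, p v * d v ^ 2 = n * σ * Z ^ n := hvar
  set R : ℝ := √(2 * σ / Z) * √n with hR
  have hR2 : R ^ 2 = 2 * σ / Z * n := by
    rw [hR, mul_pow, Real.sq_sqrt (by positivity), Real.sq_sqrt (by positivity)]
  have hR0 : 0 ≤ R := by positivity
  have hwt : ∀ v : Fin n → A, wordWeight ℓ v ≤ M * n := by
    intro v
    calc wordWeight ℓ v ≤ ∑ _i : Fin n, M := Finset.sum_le_sum fun i _ => hle _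
      _ = M * n := by simp [mul_comm]
  have hmass : Z ^ n ≤ 2 * ∑ v with |d v| ≤ R, p v := by
    have hsplit := Finset.sum_filter_add_sum_filter_not Finset.univ (fun v => |d v| ≤ R) p
    rw [htot] at hsplit
    have htail : R ^ 2 * ∑ v with ¬ |d v| ≤ R, p v ≤ ∑ v with ¬ |d v| ≤ R, p v * d v ^ 2 := by
      rw [Finset.mul_sum]
      refine Finset.sum_le_sum fun v hv => ?_
      have hlt : R < |d v| := not_le.1 (Finset.mem_filter.1 hv).2
      have : R ^ 2 ≤ d v ^ 2 := by rw [← sq_abs (d v)]; gcongr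
      nlinarith [hp0 v]
    have hsub : ∑ v with ¬ |d v| ≤ R, p v * d v ^ 2 ≤ ∑ v, p v * d v ^ 2 :=
      Finset.sum_le_sum_of_subset_of_nonneg (Finset.filter_subset _ _)
        fun v _ _ => mul_nonneg (hp0 v).le (sq_nonneg _)
    have hE : ∑ v, p v * d v ^ 2 = n * σ / Z * Z ^ n := by
      field_simp; linarith
    rcases hR0.eq_or_lt with h0 | hpos
    · -- a vanishing radius, where the division by `R ^ 2` below is not available,
      -- means that every word has weight `n T`
      have hz : ∑ v, p v * d v ^ 2 = 0 := by
        have : R ^ 2 = 0 := by rw [← h0]; simp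
        rw [hE]
        have : n * σ / Z = 0 := by
          have e : n * σ / Z = R ^ 2 / 2 := by rw [hR2]; ring
          rw [e, this]; simp
        rw [this, zero_mul]
      have hall : ∀ v, |d v| ≤ R := by
        intro v
        have := (Finset.sum_eq_zero_iff_of_nonneg
          (fun v _ => mul_nonneg (hp0 v).le (sq_nonneg (d v)))).1 hz v (Finset.mem_univ v)
        have h2 : d v = 0 := by simpa [(hp0 v).ne'] using this
        rw [h2, abs_zero]; exact hR0
      rw [Finset.filter_true_of_mem fun v _ => hall v, htot]
      linarith [pow_pos hZ n]
    · have e : n * σ / Z = R ^ 2 / 2 := by rw [hR2]; ring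
      rw [e] at hE
      have : R ^ 2 * ∑ v with ¬ |d v| ≤ R, p v ≤ R ^ 2 * (Z ^ n / 2) := by linarith
      have := le_of_mul_le_mul_left this (by positivity)
      linarith
  -- group the words in the window by weight
  set W : Finset ℕ := (Finset.range (M * n + 1)).filter fun w => |(w : ℝ) - n * T| ≤ R with hW
  have hfib : ∑ v with |d v| ≤ R, p v = ∑ w ∈ W, (sphereCount ℓ n w : ℝ) * x ^ w := by
    rw [← Finset.sum_fiberwise_of_maps_to (s := Finset.univ.filter fun v => |d v| ≤ R) (t := W)
      (g := fun v => wordWeight ℓ v)]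
    · refine Finset.sum_congr rfl fun w hw => ?_
      rw [sphereCount, ← nsmul_eq_mul, ← Finset.sum_const]
      refine Finset.sum_congr ?_ ?_
      · ext v
        simp only [Finset.mem_filter, Finset.mem_univ, true_and, and_iff_right_iff_imp]
        intro hv
        simp only [hd, hv]
        exact (Finset.mem_filter.1 hw).2
      · intro v hv
        rw [hp]; simp only [(Finset.mem_filter.1 hv).2]
    · intro v hv
      simp only [hW, Finset.mem_filter, Finset.mem_range]
      exact ⟨Nat.lt_succ_of_le (hwt v), (Finset.mem_filter.1 hv).2⟩
  by_contra! hcon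
  have hlt : ∀ w ∈ W, 2 * ((M : ℝ) * n + 1) * (sphereCount ℓ n w * x ^ w) < Z ^ n :=
    fun w hw => hcon w (Finset.mem_filter.1 hw).2
  have hWne : W.Nonempty := by
    rw [Finset.nonempty_iff_ne_empty]
    intro h0
    rw [hfib, h0, Finset.sum_empty] at hmass
    linarith [pow_pos hZ n]
  have h1 := Finset.sum_lt_sum_of_nonempty hWne hlt
  rw [← Finset.mul_sum, ← hfib, Finset.sum_const, nsmul_eq_mul] at h1
  have hcard : (W.card : ℝ) ≤ M * n + 1 := by
    have := (Finset.card_filter_le (Finset.range (M * n + 1)) fun w => |(w : ℝ) - n * T| ≤ R)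
    rw [Finset.card_range] at this
    exact_mod_cast this
  have hMn : (0 : ℝ) < M * n + 1 := by positivity
  nlinarith [pow_pos hZ n]

/-! ### The saddle point -/

/-- For `r > 1` the map `i ↦ (i - T) r ^ i` dominates `(i - T) r ^ T`; hence `x ^ (-T)` times the
saddle function is strictly increasing. -/
theorem saddleFun_lt {ℓ : A → ℕ} (h0 : ∃ a, ℓ a = 0) {T x y : ℝ} (hT : 0 < T) (hx : 0 < x)
    (hxy : x < y) : (y / x) ^ T * saddleFun ℓ T x < saddleFun ℓ T y := by
  have hr : 1 < y / x := (one_lt_div hx).2 hxy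
  set r := y / x with hrdef
  have hy : y = r * x := by rw [hrdef]; field_simp
  have key : ∀ i : ℕ, (i : ℝ) ≠ T → ((i : ℝ) - T) * r ^ T < ((i : ℝ) - T) * r ^ i := by
    intro i hi
    rw [← Real.rpow_natCast r i]
    rcases lt_or_gt_of_ne hi with h | h
    · exact mul_lt_mul_of_neg_left (Real.rpow_lt_rpow_of_exponent_lt hr h) (by linarith)
    · exact mul_lt_mul_of_pos_left (Real.rpow_lt_rpow_of_exponent_lt hr h) (by linarith)
  unfold saddleFun
  rw [Finset.mul_sum]
  refine Finset.sum_lt_sum (fun a _ => ?_) ?_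
  · rcases eq_or_ne (ℓ a : ℝ) T with h | h
    · simp [h]
    · rw [hy, mul_pow]
      nlinarith [mul_lt_mul_of_pos_right (key _ h) (pow_pos hx (ℓ a))]
  · obtain ⟨a, ha⟩ := h0
    refine ⟨a, Finset.mem_univ _, ?_⟩
    have := mul_lt_mul_of_pos_right (key (ℓ a) (by rw [ha]; simpa using hT.ne))
      (pow_pos hx (ℓ a))
    rw [hy, mul_pow]
    nlinarith

theorem existsUnique_saddle {ℓ : A → ℕ} {M : ℕ} (hle : ∀ a, ℓ a ≤ M)
    (hsurj : ∀ j ≤ M, ∃ a, ℓ a = j) {T : ℝ} (hT : 0 < T) (hTM : T < M) :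
    ∃! ρ : ℝ, 0 < ρ ∧ saddleFun ℓ T ρ = 0 := by
  have h0 := hsurj 0 (Nat.zero_le _)
  have hcont : Continuous (saddleFun ℓ T) := by unfold saddleFun; fun_prop
  have hneg : saddleFun ℓ T 0 < 0 := by
    obtain ⟨a, ha⟩ := h0
    refine Finset.sum_neg' (fun b _ => ?_) ⟨a, Finset.mem_univ _, by simp [ha, hT]⟩
    rcases Nat.eq_zero_or_pos (ℓ b) with h | h
    · simp [h, hT.le]
    · simp [h.ne']
  have hM : 1 ≤ M := by
    have : (0 : ℝ) < M := hT.trans hTM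
    exact_mod_cast this
  -- at this point the terms of top weight outweigh all the others
  set X : ℝ := 1 + Fintype.card A * T / (M - T) with hX
  have hMT : 0 < (M : ℝ) - T := by linarith
  have hX1 : 1 ≤ X := by rw [hX]; linarith [show 0 ≤ Fintype.card A * T / (M - T) by positivity]
  have hpos : 0 < saddleFun ℓ T X := by
    obtain ⟨a, ha⟩ := hsurj M le_rfl
    have hterm : ∀ b, -(T * X ^ (M - 1)) ≤ ((ℓ b : ℝ) - T) * X ^ ℓ b := by
      intro b
      rcases (hle b).eq_or_lt with h | h
      · rw [h]
        have : 0 ≤ ((M : ℝ) - T) * X ^ M := by positivity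
        have : 0 ≤ T * X ^ (M - 1) := by positivity
        linarith
      · have h1 : X ^ ℓ b ≤ X ^ (M - 1) := pow_le_pow_right₀ hX1 (by omega)
        have h2 : 0 ≤ (ℓ b : ℝ) * X ^ ℓ b := by positivity
        nlinarith
    have hlow : ∑ b : A, (((ℓ b : ℝ) - T) * X ^ ℓ b + T * X ^ (M - 1)) ≥
        ((M : ℝ) - T) * X ^ M := by
      have h1 := Finset.single_le_sum (f := fun b => ((ℓ b : ℝ) - T) * X ^ ℓ b + T * X ^ (M - 1))
        (fun b _ => by linarith [hterm b]) (Finset.mem_univ a)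
      simp only [ha] at h1
      have : 0 ≤ T * X ^ (M - 1) := by positivity
      linarith
    rw [Finset.sum_add_distrib, Finset.sum_const, Finset.card_univ, nsmul_eq_mul] at hlow
    have hXM : X ^ M = X ^ (M - 1) * X := by rw [← pow_succ]; congr 1; omega
    have hval : ((M : ℝ) - T) * X = (M - T) + Fintype.card A * T := by rw [hX]; field_simp
    have hpp : 0 < X ^ (M - 1) := by positivity
    have : ((M : ℝ) - T) * X ^ M = X ^ (M - 1) * ((M - T) + Fintype.card A * T) := by
      rw [hXM, ← hval]; ring
    unfold saddleFun
    nlinarith [mul_pos hpp hMT]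
  obtain ⟨ρ, hρ, hρ0⟩ := intermediate_value_Icc (zero_le_one.trans hX1) hcont.continuousOn
    ⟨hneg.le, hpos.le⟩
  have hρpos : 0 < ρ := by
    rcases hρ.1.eq_or_lt with h | h
    · rw [← h] at hρ0; linarith
    · exact h
  refine ⟨ρ, ⟨hρpos, hρ0⟩, fun y ⟨hy, hy0⟩ => ?_⟩
  rcases lt_trichotomy y ρ with h | h | h
  · have := saddleFun_lt h0 hT hy h
    rw [hy0, hρ0] at this; simp at this
  · exact h
  · have := saddleFun_lt h0 hT hρpos h
    rw [hy0, hρ0] at this; simp at this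

/-- If `T` lies below the mean letter weight, then the saddle point lies below `1`. -/
theorem saddle_lt_one {ℓ : A → ℕ} (h0 : ∃ a, ℓ a = 0) {T ρ : ℝ} (hT : 0 < T)
    (hρ : saddleFun ℓ T ρ = 0) (hmean : 0 < ∑ a, ((ℓ a : ℝ) - T)) : ρ < 1 := by
  have h1 : 0 < saddleFun ℓ T 1 := by simpa [saddleFun] using hmean
  by_contra! h
  rcases h.eq_or_lt with h | h
  · rw [h, hρ] at h1; exact h1.false
  · have := saddleFun_lt h0 hT one_pos h
    rw [hρ] at this
    have : 0 < (ρ / 1) ^ T * saddleFun ℓ T 1 := by positivity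
    linarith

/-! ### Exponential growth rates -/

theorem log_count_div_le {c Z x : ℝ} {n w : ℕ} (hn : 0 < n) (hc : 0 < c) (hx : 0 < x)
    (h : c * x ^ w ≤ Z ^ n) : Real.log c / n ≤ Real.log Z - (w : ℝ) / n * Real.log x := by
  have h1 := Real.log_le_log (by positivity) h
  rw [Real.log_mul hc.ne' (by positivity), Real.log_pow, Real.log_pow] at h1
  have hn' : (0 : ℝ) < n := by exact_mod_cast hn
  rw [div_le_iff₀ hn']
  have : (Real.log Z - (w : ℝ) / n * Real.log x) * n = n * Real.log Z - w * Real.log x := by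
    field_simp
  linarith

theorem eventually_sphereCount_pos {ℓ : A → ℕ} {M : ℕ} (hsurj : ∀ j ≤ M, ∃ a, ℓ a = j) {t : ℕ → ℕ}
    {T : ℝ} (ht : Tendsto (fun n : ℕ => (t n : ℝ) / n) atTop (𝓝 T)) (hTM : T < M) :
    ∀ᶠ n in atTop, 0 < sphereCount ℓ n (t n) := by
  filter_upwards [ht.eventually_lt_const hTM, eventually_gt_atTop 0] with n h hn
  refine sphereCount_pos hsurj ?_
  rw [div_lt_iff₀ (by exact_mod_cast hn)] at h
  exact_mod_cast h.le

/-- The lower bound: the heavy weight of a block of length `n - k` is padded by `k = o(n)` further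
letters to a word of weight exactly `t n`. -/
theorem exists_le_log_sphereCount {ℓ : A → ℕ} {M : ℕ} (hle : ∀ a, ℓ a ≤ M)
    (hsurj : ∀ j ≤ M, ∃ a, ℓ a = j) {t : ℕ → ℕ} {T ρ : ℝ}
    (ht : Tendsto (fun n : ℕ => (t n : ℝ) / n) atTop (𝓝 T)) (hT : 0 < T) (hTM : T < M)
    (hρ : 0 < ρ) (h : saddleFun ℓ T ρ = 0) :
    ∃ b : ℕ → ℝ, Tendsto b atTop (𝓝 (Real.log (enumerator ℓ ρ) - T * Real.log ρ)) ∧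
      ∀ᶠ n in atTop, b n ≤ Real.log (sphereCount ℓ n (t n)) / n := by
  have hne : Nonempty A := (hsurj 0 (Nat.zero_le _)).nonempty
  have hZ := enumerator_pos ℓ hρ
  obtain ⟨C, hC, hheavy⟩ := exists_heavy_weight hle hρ h
  choose w hw hmass using hheavy
  set Z := enumerator ℓ ρ
  set c : ℝ := min T (M - T) with hc
  have hc0 : 0 < c := lt_min hT (by linarith)
  -- the total deviation that the padding has to absorb
  set e : ℕ → ℝ := fun n => |(t n : ℝ) - n * T| + C * √n with he
  have he0 : ∀ n, 0 ≤ e n := fun n => by positivity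
  set k : ℕ → ℕ := fun n => ⌈e n / c⌉₊ with hk
  have hinv : Tendsto (fun n : ℕ => ((n : ℝ))⁻¹) atTop (𝓝 0) := tendsto_inv_atTop_nhds_zero_nat
  have hsqrt : Tendsto (fun n : ℕ => √(n : ℝ) / n) atTop (𝓝 0) := by
    have h1 : Tendsto (fun n : ℕ => √((n : ℝ)⁻¹)) atTop (𝓝 0) := by
      have := (Real.continuous_sqrt.tendsto 0).comp hinv
      rwa [Real.sqrt_zero] at this
    refine h1.congr' ?_
    filter_upwards with n
    rw [Real.sqrt_inv, Real.sqrt_div_self]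
  have hdev : Tendsto (fun n : ℕ => e n / n) atTop (𝓝 0) := by
    have h1 : Tendsto (fun n : ℕ => |(t n : ℝ) / n - T| + C * (√(n : ℝ) / n)) atTop (𝓝 0) := by
      simpa using ((ht.sub_const T).abs).add (hsqrt.const_mul C)
    refine h1.congr' ?_
    filter_upwards [eventually_gt_atTop 0] with n hn
    have hn' : (0 : ℝ) < n := by exact_mod_cast hn
    have : (t n : ℝ) / n - T = ((t n : ℝ) - n * T) / n := by field_simp
    rw [this, abs_div, abs_of_pos hn', he]
    ring
  have hkn : Tendsto (fun n : ℕ => (k n : ℝ) / n) atTop (𝓝 0) := by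
    have h1 : Tendsto (fun n : ℕ => e n / n / c + (n : ℝ)⁻¹) atTop (𝓝 0) := by
      simpa using (hdev.div_const c).add hinv
    refine squeeze_zero (fun n => by positivity) (fun n => ?_) h1
    have h2 : (k n : ℝ) ≤ e n / c + 1 := (Nat.ceil_lt_add_one (div_nonneg (he0 n) hc0.le)).le
    calc (k n : ℝ) / n ≤ (e n / c + 1) / n := by gcongr
      _ = _ := by ring
  have hkle : ∀ᶠ n in atTop, k n ≤ n := by
    filter_upwards [hkn.eventually_lt_const one_pos, eventually_gt_atTop 0] with n h1 hn
    rw [div_lt_one (by exact_mod_cast hn)] at h1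
    exact_mod_cast h1.le
  have hwdev : ∀ᶠ n in atTop, |(w (n - k n) : ℝ) / n - T| ≤ C * (√(n : ℝ) / n) + T * (k n / n) := by
    filter_upwards [hkle, eventually_gt_atTop 0] with n hkn hn
    have hn' : (0 : ℝ) < n := by exact_mod_cast hn
    have h1 := hw (n - k n)
    rw [Nat.cast_sub hkn] at h1
    have h2 : √((n : ℝ) - k n) ≤ √n := Real.sqrt_le_sqrt (by linarith [(k n).cast_nonneg (α := ℝ)])
    have h3 : |(w (n - k n) : ℝ) - n * T| ≤ C * √n + T * k n := by
      have : (w (n - k n) : ℝ) - n * T = (w (n - k n) - (n - k n) * T) - T * k n := by ring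
      rw [this]
      refine (abs_sub _ _).trans ?_
      rw [abs_of_nonneg (show 0 ≤ T * (k n : ℝ) by positivity)]
      have := mul_le_mul_of_nonneg_left h2 hC
      linarith
    have : (w (n - k n) : ℝ) / n - T = ((w (n - k n) : ℝ) - n * T) / n := by field_simp
    rw [this, abs_div, abs_of_pos hn', div_le_iff₀ hn']
    refine h3.trans (le_of_eq ?_)
    field_simp
  have hwT : Tendsto (fun n : ℕ => (w (n - k n) : ℝ) / n) atTop (𝓝 T) := by
    rw [tendsto_iff_norm_sub_tendsto_zero]
    refine squeeze_zero' (Eventually.of_forall fun n => norm_nonneg _) hwdev ?_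
    simpa using (hsqrt.const_mul C).add (hkn.const_mul T)
  have hlog : Tendsto (fun n : ℕ => Real.log (2 * (M * n + 1)) / n) atTop (𝓝 0) := by
    have h1 := Real.isLittleO_log_id_atTop.tendsto_div_nhds_zero
    have h2 : Tendsto (fun n : ℕ => 2 * ((M : ℝ) * n + 1)) atTop atTop := by
      have : (0 : ℝ) < M := hT.trans hTM
      exact ((tendsto_natCast_atTop_atTop.const_mul_atTop this).atTop_add
        tendsto_const_nhds).const_mul_atTop two_pos
    have h3 : Tendsto (fun n : ℕ => 2 * ((M : ℝ) + (n : ℝ)⁻¹)) atTop (𝓝 (2 * (M + 0))) :=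
      (hinv.const_add _).const_mul 2
    have h4 := (h1.comp h2).mul h3
    rw [zero_mul] at h4
    refine h4.congr' ?_
    filter_upwards [eventually_gt_atTop 0] with n hn
    have hn' : (0 : ℝ) < n := by exact_mod_cast hn
    simp only [Function.comp, id]
    have : (0 : ℝ) < M * n + 1 := by positivity
    field_simp
  refine ⟨fun n => (1 - (k n : ℝ) / n) * Real.log Z - (w (n - k n) : ℝ) / n * Real.log ρ -
    Real.log (2 * (M * n + 1)) / n, ?_, ?_⟩
  · simpa using (((hkn.const_sub 1).mul_const (Real.log Z)).sub (hwT.mul_const (Real.log ρ))).sub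
      hlog
  filter_upwards [hkle, eventually_gt_atTop 0] with n hkn hn
  have hn' : (0 : ℝ) < n := by exact_mod_cast hn
  set m := n - k n with hm
  have hmn : (m : ℝ) = n - k n := by rw [hm, Nat.cast_sub hkn]
  have hek : e n ≤ c * k n := by
    have := Nat.le_ceil (e n / c)
    rw [div_le_iff₀ hc0] at this
    linarith
  have hsq : √(m : ℝ) ≤ √n :=
    Real.sqrt_le_sqrt (by rw [hmn]; linarith [(k n).cast_nonneg (α := ℝ)])
  have hdiff : |((t n : ℝ) - n * T) - (w m - m * T)| ≤ c * k n := by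
    refine (abs_sub _ _).trans (le_trans ?_ hek)
    have := mul_le_mul_of_nonneg_left hsq hC
    simp only [he]
    linarith [hw m]
  have hdiff' := abs_le.1 hdiff
  have hk0 := (k n).cast_nonneg (α := ℝ)
  have hcT : c * k n ≤ T * k n := mul_le_mul_of_nonneg_right (min_le_left _ _) hk0
  have hcM : c * k n ≤ (M - T) * k n := mul_le_mul_of_nonneg_right (min_le_right _ _) hk0
  rw [hmn] at hdiff'
  have hwt : w m ≤ t n := by
    have : (w m : ℝ) ≤ t n := by linarith
    exact_mod_cast this
  have hpad : t n - w m ≤ M * k n := by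
    have : (t n : ℝ) ≤ M * k n + w m := by linarith
    have : t n ≤ M * k n + w m := by exact_mod_cast this
    omega
  have hcnt : sphereCount ℓ m (w m) ≤ sphereCount ℓ n (t n) := by
    have := sphereCount_le_add hsurj hpad m (w m)
    rwa [hm, Nat.sub_add_cancel hkn, ← hm, Nat.add_sub_cancel' hwt] at this
  have hfin : Z ^ m ≤ 2 * (M * n + 1) * (sphereCount ℓ n (t n) * ρ ^ w m) := by
    refine (hmass m).trans ?_
    have : (m : ℝ) ≤ n := by rw [hmn]; linarith
    have : (sphereCount ℓ m (w m) : ℝ) ≤ sphereCount ℓ n (t n) := by exact_mod_cast hcnt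
    gcongr
  have hspos : (0 : ℝ) < sphereCount ℓ n (t n) := by
    rcases (Nat.cast_nonneg (α := ℝ) (sphereCount ℓ n (t n))).eq_or_lt with h0 | h0
    · rw [← h0] at hfin
      have := pow_pos hZ m
      simp only [zero_mul, mul_zero] at hfin
      linarith
    · exact h0
  have hL := Real.log_le_log (pow_pos hZ m) hfin
  rw [Real.log_mul (x := 2 * ((M : ℝ) * n + 1)) (by positivity) (by positivity),
    Real.log_mul (y := ρ ^ w m) hspos.ne' (by positivity), Real.log_pow, Real.log_pow, hmn] at hL
  rw [le_div_iff₀ hn']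
  have : ((1 - (k n : ℝ) / n) * Real.log Z - (w m : ℝ) / n * Real.log ρ -
      Real.log (2 * (M * n + 1)) / n) * n =
      (n - k n) * Real.log Z - w m * Real.log ρ - Real.log (2 * (M * n + 1)) := by
    field_simp
  rw [this]
  linarith

theorem tendsto_log_sphereCount {ℓ : A → ℕ} {M : ℕ} (hle : ∀ a, ℓ a ≤ M)
    (hsurj : ∀ j ≤ M, ∃ a, ℓ a = j) {t : ℕ → ℕ} {T ρ : ℝ}
    (ht : Tendsto (fun n : ℕ => (t n : ℝ) / n) atTop (𝓝 T)) (hT : 0 < T) (hTM : T < M)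
    (hρ : 0 < ρ) (h : saddleFun ℓ T ρ = 0) :
    Tendsto (fun n : ℕ => Real.log (sphereCount ℓ n (t n)) / n) atTop
      (𝓝 (Real.log (enumerator ℓ ρ) - T * Real.log ρ)) := by
  have hne : Nonempty A := (hsurj 0 (Nat.zero_le _)).nonempty
  obtain ⟨b, hb, hbl⟩ := exists_le_log_sphereCount hle hsurj ht hT hTM hρ h
  refine tendsto_of_tendsto_of_tendsto_of_le_of_le' hb
    ((ht.mul_const (Real.log ρ)).const_sub _) hbl ?_
  filter_upwards [eventually_sphereCount_pos hsurj ht hTM, eventually_gt_atTop 0] with n h1 hn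
  exact log_count_div_le hn (by exact_mod_cast h1) hρ
    (sphereCount_mul_pow_le ℓ n (t n) hρ)

theorem log_sphereCount_div_le {ℓ : A → ℕ} {n w : ℕ} (h : 0 < sphereCount ℓ n w) :
    Real.log (sphereCount ℓ n w) / n ≤ Real.log (ballCount ℓ n w) / n := by
  have h1 : (0 : ℝ) < sphereCount ℓ n w := by exact_mod_cast h
  have h2 : (sphereCount ℓ n w : ℝ) ≤ ballCount ℓ n w := by
    exact_mod_cast sphereCount_le_ballCount ℓ n w
  gcongr

theorem tendsto_log_ballCount {ℓ : A → ℕ} {M : ℕ} (hle : ∀ a, ℓ a ≤ M)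
    (hsurj : ∀ j ≤ M, ∃ a, ℓ a = j) {t : ℕ → ℕ} {T ρ : ℝ}
    (ht : Tendsto (fun n : ℕ => (t n : ℝ) / n) atTop (𝓝 T)) (hT : 0 < T) (hTM : T < M)
    (hρ : 0 < ρ) (h : saddleFun ℓ T ρ = 0) (hmean : 0 < ∑ a, ((ℓ a : ℝ) - T)) :
    Tendsto (fun n : ℕ => Real.log (ballCount ℓ n (t n)) / n) atTop
      (𝓝 (Real.log (enumerator ℓ ρ) - T * Real.log ρ)) := by
  have h0 := hsurj 0 (Nat.zero_le _)
  have hne : Nonempty A := h0.nonempty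
  refine tendsto_of_tendsto_of_tendsto_of_le_of_le'
    (tendsto_log_sphereCount hle hsurj ht hT hTM hρ h)
    ((ht.mul_const (Real.log ρ)).const_sub _) ?_ ?_
  · filter_upwards [eventually_sphereCount_pos hsurj ht hTM] with n h1
    exact log_sphereCount_div_le h1
  · filter_upwards [eventually_sphereCount_pos hsurj ht hTM, eventually_gt_atTop 0] with n h1 hn
    exact log_count_div_le hn (by exact_mod_cast h1.trans_le (sphereCount_le_ballCount ℓ n (t n)))
      hρ (ballCount_mul_pow_le ℓ n (t n) hρ (saddle_lt_one h0 hT h hmean).le)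

/-- With `t n = o(n)` the ball grows subexponentially: the bound by the enumerator at `x`, whose
exponent tends to `log (enumerator x)`, is used with `x` close to `0`. -/
theorem tendsto_log_count_zero {ℓ : A → ℕ} {M : ℕ} (hM : 0 < M)
    (hsurj : ∀ j ≤ M, ∃ a, ℓ a = j) (h0 : ∃! a, ℓ a = 0) {t : ℕ → ℕ}
    (ht : Tendsto (fun n : ℕ => (t n : ℝ) / n) atTop (𝓝 0)) :
    Tendsto (fun n : ℕ => Real.log (sphereCount ℓ n (t n)) / n) atTop (𝓝 0) ∧
    Tendsto (fun n : ℕ => Real.log (ballCount ℓ n (t n)) / n) atTop (𝓝 0) := by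
  have hne : Nonempty A := h0.exists.nonempty
  have hpos := eventually_sphereCount_pos hsurj ht (by exact_mod_cast hM)
  have hball : Tendsto (fun n : ℕ => Real.log (ballCount ℓ n (t n)) / n) atTop (𝓝 0) := by
    rw [tendsto_order]
    constructor
    · intro a ha
      exact Eventually.of_forall fun n => ha.trans_le
        (div_nonneg (Real.log_natCast_nonneg _) (Nat.cast_nonneg _))
    · intro η hη
      have hZ0 : enumerator ℓ 0 = 1 := by
        obtain ⟨a, ha, hu⟩ := h0
        unfold enumerator
        rw [Finset.sum_eq_single a]
        · simp [show ℓ a = 0 from ha]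
        · intro b _ hb
          exact zero_pow fun hb0 => hb (hu b hb0)
        · simp
      have hcont : ContinuousAt (fun x => Real.log (enumerator ℓ x)) 0 := by
        refine ContinuousAt.log ?_ (by rw [hZ0]; exact one_ne_zero)
        unfold enumerator; fun_prop
      have hev : ∀ᶠ x in 𝓝 (0 : ℝ), Real.log (enumerator ℓ x) < η := by
        refine hcont.eventually_lt continuousAt_const ?_
        rw [hZ0, Real.log_one]; exact hη
      obtain ⟨x, hxη, hx0, hx1⟩ : ∃ x : ℝ, Real.log (enumerator ℓ x) < η ∧ 0 < x ∧ x ≤ 1 := by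
        have := (hev.filter_mono nhdsWithin_le_nhds).and
          (Ioc_mem_nhdsGT (zero_lt_one' ℝ) : Set.Ioc (0 : ℝ) 1 ∈ 𝓝[>] 0)
        obtain ⟨x, hx⟩ := this.exists
        exact ⟨x, hx.1, hx.2.1, hx.2.2⟩
      have hlim : Tendsto (fun n : ℕ => Real.log (enumerator ℓ x) - (t n : ℝ) / n * Real.log x)
          atTop (𝓝 (Real.log (enumerator ℓ x))) := by
        simpa using (ht.mul_const (Real.log x)).const_sub (Real.log (enumerator ℓ x))
      filter_upwards [hlim.eventually_lt_const hxη, hpos, eventually_gt_atTop 0] with n h1 h2 hn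
      exact (log_count_div_le hn
        (by exact_mod_cast h2.trans_le (sphereCount_le_ballCount ℓ n (t n)))
        hx0 (ballCount_mul_pow_le ℓ n (t n) hx0 hx1)).trans_lt h1
  refine ⟨tendsto_of_tendsto_of_tendsto_of_le_of_le' tendsto_const_nhds hball
    (Eventually.of_forall fun n =>
      div_nonneg (Real.log_natCast_nonneg _) (Nat.cast_nonneg _)) ?_, hball⟩
  filter_upwards [hpos] with n h1
  exact log_sphereCount_div_le h1

/-! ### The Lee alphabet -/

theorem leeSphereSize_eq {m : ℕ} [NeZero m] (n w : ℕ) :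
    leeSphereSize n w m = sphereCount (leeWeight (m := m)) n w := by
  classical
  rw [leeSphereSize, sphereCount, ← Set.ncard_coe_finset]
  congr 1
  ext v
  simp only [Finset.coe_filter, Finset.mem_univ, true_and]
  rfl

theorem leeBallSize_eq {m : ℕ} [NeZero m] (n w : ℕ) :
    leeBallSize n w m = ballCount (leeWeight (m := m)) n w := by
  classical
  rw [leeBallSize, ballCount, ← Set.ncard_coe_finset]
  congr 1
  ext v
  simp only [Finset.coe_filter, Finset.mem_univ, true_and]
  rfl

theorem leeWeight_le {m : ℕ} (x : ZMod m) : leeWeight x ≤ m / 2 := by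
  unfold leeWeight; omega

theorem exists_leeWeight_eq {m : ℕ} [NeZero m] : ∀ j ≤ m / 2, ∃ x : ZMod m, leeWeight x = j := by
  intro j hj
  have hm := NeZero.pos m
  refine ⟨(j : ZMod m), ?_⟩
  rw [leeWeight, ZMod.val_cast_of_lt (by omega)]
  omega

theorem existsUnique_leeWeight_eq_zero {m : ℕ} [NeZero m] : ∃! x : ZMod m, leeWeight x = 0 := by
  refine ⟨0, by simp [leeWeight], fun x hx => ?_⟩
  have := ZMod.val_lt x
  unfold leeWeight at hx
  exact (ZMod.val_eq_zero x).1 (by omega)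

/-- A sum over `ℤ/mℤ` as a sum over the representatives `0, …, m - 1`. -/
theorem sum_leeWeight_eq_range {m : ℕ} [NeZero m] (φ : ℕ → ℝ) :
    ∑ x : ZMod m, φ (leeWeight x) = ∑ i ∈ Finset.range m, φ (min i (m - i)) := by
  obtain ⟨k, rfl⟩ := Nat.exists_eq_succ_of_ne_zero (NeZero.ne m)
  rw [Finset.sum_range]
  rfl

theorem sum_Icc_one_eq_sum_range (M : ℕ) (φ : ℕ → ℝ) :
    ∑ i ∈ Finset.Icc 1 M, φ i = ∑ i ∈ Finset.range M, φ (i + 1) := by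
  induction M with
  | zero => simp
  | succ k ih => rw [Finset.sum_Icc_succ_top (by omega), Finset.sum_range_succ, ih]

theorem sum_leeWeight_odd (M : ℕ) (φ : ℕ → ℝ) :
    ∑ x : ZMod (2 * M + 1), φ (leeWeight x) = φ 0 + 2 * ∑ i ∈ Finset.Icc 1 M, φ i := by
  rw [sum_leeWeight_eq_range, sum_Icc_one_eq_sum_range,
    show Finset.range (2 * M + 1) = Finset.range ((M + 1) + M) by congr 1; ring,
    Finset.sum_range_add]
  have h1 : ∑ i ∈ Finset.range (M + 1), φ (min i (2 * M + 1 - i)) =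
      ∑ i ∈ Finset.range (M + 1), φ i := by
    refine Finset.sum_congr rfl fun i hi => ?_
    rw [Finset.mem_range] at hi
    rw [min_eq_left (by omega)]
  have h2 : ∑ i ∈ Finset.range M, φ (min (M + 1 + i) (2 * M + 1 - (M + 1 + i))) =
      ∑ i ∈ Finset.range M, φ (i + 1) := by
    rw [← Finset.sum_range_reflect (fun i => φ (i + 1))]
    refine Finset.sum_congr rfl fun i hi => ?_
    rw [Finset.mem_range] at hi
    congr 1; omega
  rw [h1, h2, Finset.sum_range_succ']
  ring

theorem sum_leeWeight_even (M : ℕ) [NeZero (2 * M)] (φ : ℕ → ℝ) :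
    ∑ x : ZMod (2 * M), φ (leeWeight x) =
      φ 0 + 2 * ∑ i ∈ Finset.Icc 1 (M - 1), φ i + φ M := by
  obtain ⟨k, rfl⟩ : ∃ k, M = k + 1 := ⟨M - 1, by have := NeZero.ne (2 * M); omega⟩
  rw [sum_leeWeight_eq_range, Nat.add_sub_cancel, sum_Icc_one_eq_sum_range,
    show Finset.range (2 * (k + 1)) = Finset.range ((k + 1 + 1) + k) by congr 1; ring,
    Finset.sum_range_add]
  have h1 : ∑ i ∈ Finset.range (k + 1 + 1), φ (min i (2 * (k + 1) - i)) =
      ∑ i ∈ Finset.range (k + 1 + 1), φ i := by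
    refine Finset.sum_congr rfl fun i hi => ?_
    rw [Finset.mem_range] at hi
    rw [min_eq_left (by omega)]
  have h2 : ∑ i ∈ Finset.range k, φ (min (k + 1 + 1 + i) (2 * (k + 1) - (k + 1 + 1 + i))) =
      ∑ i ∈ Finset.range k, φ (i + 1) := by
    rw [← Finset.sum_range_reflect (fun i => φ (i + 1))]
    refine Finset.sum_congr rfl fun i hi => ?_
    rw [Finset.mem_range] at hi
    congr 1; omega
  rw [h1, h2, Finset.sum_range_succ, Finset.sum_range_succ']
  ring

theorem enumerator_lee_odd (M : ℕ) (x : ℝ) :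
    enumerator (leeWeight (m := 2 * M + 1)) x = leeGenOdd M x := by
  rw [enumerator, sum_leeWeight_odd M (fun i => x ^ i), leeGenOdd, pow_zero]

theorem enumerator_lee_even (M : ℕ) [NeZero (2 * M)] (x : ℝ) :
    enumerator (leeWeight (m := 2 * M)) x = leeGenEven M x := by
  rw [enumerator, sum_leeWeight_even M (fun i => x ^ i), leeGenEven, pow_zero]

theorem isLeeSaddleOdd_iff (M : ℕ) (T x : ℝ) :
    IsLeeSaddleOdd M T x ↔ saddleFun (leeWeight (m := 2 * M + 1)) T x = 0 := by
  rw [saddleFun, sum_leeWeight_odd M (fun i => ((i : ℝ) - T) * x ^ i), IsLeeSaddleOdd]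
  simp only [Nat.cast_zero, zero_sub, pow_zero, mul_one]
  constructor <;> intro h <;> linarith

theorem isLeeSaddleEven_iff (M : ℕ) [NeZero (2 * M)] (T x : ℝ) :
    IsLeeSaddleEven M T x ↔ saddleFun (leeWeight (m := 2 * M)) T x = 0 := by
  rw [saddleFun, sum_leeWeight_even M (fun i => ((i : ℝ) - T) * x ^ i), IsLeeSaddleEven]
  simp only [Nat.cast_zero, zero_sub, pow_zero, mul_one]
  constructor <;> intro h <;> linarith

theorem two_mul_sum_Icc_sub (M : ℕ) (T : ℝ) :
    2 * ∑ i ∈ Finset.Icc 1 M, ((i : ℝ) - T) = M * (M + 1) - 2 * M * T := by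
  induction M with
  | zero => simp
  | succ k ih => rw [Finset.sum_Icc_succ_top (by omega), mul_add, ih]; push_cast; ring

theorem sum_leeWeight_sub_odd_pos {M : ℕ} {T : ℝ}
    (hT : T < (M : ℝ) * ((M : ℝ) + 1) / (2 * (M : ℝ) + 1)) :
    0 < ∑ x : ZMod (2 * M + 1), ((leeWeight x : ℝ) - T) := by
  rw [sum_leeWeight_odd M (fun i => (i : ℝ) - T), two_mul_sum_Icc_sub]
  rw [lt_div_iff₀ (by positivity)] at hT
  simp only [Nat.cast_zero]
  linarith

theorem sum_leeWeight_sub_even_pos {M : ℕ} [NeZero (2 * M)] {T : ℝ} (hT : T < (M : ℝ) / 2) :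
    0 < ∑ x : ZMod (2 * M), ((leeWeight x : ℝ) - T) := by
  have hM : 1 ≤ M := by have := NeZero.ne (2 * M); omega
  have hM' : (0 : ℝ) < M := by exact_mod_cast hM
  rw [sum_leeWeight_even M (fun i => (i : ℝ) - T), two_mul_sum_Icc_sub]
  push_cast [Nat.cast_sub hM]
  nlinarith

/-! ### Closed forms at the saddle point -/

theorem one_sub_mul_sum_Icc_pow (k : ℕ) (x : ℝ) :
    (1 - x) * ∑ i ∈ Finset.Icc 1 k, x ^ i = x - x ^ (k + 1) := by
  induction k with
  | zero => simp
  | succ k ih => rw [Finset.sum_Icc_succ_top (by omega), mul_add, ih]; ring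

theorem one_sub_mul_sum_Icc_mul_pow (k : ℕ) (x : ℝ) :
    (1 - x) * ∑ i ∈ Finset.Icc 1 k, (i : ℝ) * x ^ i =
      ∑ i ∈ Finset.Icc 1 k, x ^ i - k * x ^ (k + 1) := by
  induction k with
  | zero => simp
  | succ k ih =>
    rw [Finset.sum_Icc_succ_top (by omega), Finset.sum_Icc_succ_top (by omega), mul_add, ih]
    push_cast; ring

theorem leeGenOdd_eq_div {M : ℕ} {T ρ : ℝ} (hρ : 0 < ρ) (h : IsLeeSaddleOdd M T ρ) :
    leeGenOdd M ρ = ((M : ℝ) * (ρ + 1) + 1) / ((1 - ρ) * ((M : ℝ) - T) + 1) := by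
  have key : leeGenOdd M ρ * ((1 - ρ) * ((M : ℝ) - T) + 1) = (M : ℝ) * (ρ + 1) + 1 := by
    have h1 := one_sub_mul_sum_Icc_pow M ρ
    have h2 := one_sub_mul_sum_Icc_mul_pow M ρ
    unfold IsLeeSaddleOdd at h
    simp only [sub_mul, Finset.sum_sub_distrib, ← Finset.mul_sum] at h
    unfold leeGenOdd
    -- combine `(1 - ρ)` times the saddle equation with the two telescoped geometric sums
    linear_combination (1 - ρ) * h + 2 * M * h1 - 2 * h2
  -- the denominator cannot vanish, since its product with `leeGenOdd M ρ` is positive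
  have hden : (1 - ρ) * ((M : ℝ) - T) + 1 ≠ 0 := by
    intro h0
    rw [h0, mul_zero] at key
    have : 0 < (M : ℝ) * (ρ + 1) + 1 := by positivity
    linarith
  exact (eq_div_iff hden).2 key

theorem mul_leeGenEven_eq {M : ℕ} (hM : 1 ≤ M) {T ρ : ℝ} (h : IsLeeSaddleEven M T ρ) :
    ((1 - ρ) * ((M : ℝ) - T) + 1) * leeGenEven M ρ = (M : ℝ) * (ρ + 1) + 1 - ρ ^ M := by
  have h1 := one_sub_mul_sum_Icc_pow (M - 1) ρ
  have h2 := one_sub_mul_sum_Icc_mul_pow (M - 1) ρ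
  rw [Nat.sub_add_cancel hM] at h1 h2
  rw [Nat.cast_sub hM, Nat.cast_one] at h2
  unfold IsLeeSaddleEven at h
  simp only [sub_mul, Finset.sum_sub_distrib, ← Finset.mul_sum] at h
  unfold leeGenEven
  linear_combination (1 - ρ) * h + 2 * M * h1 - 2 * h2

/-! ### The growth rates of Lee spheres and balls -/

theorem tendsto_logb_of_tendsto_log {q : ℕ} {a b : ℕ → ℕ} (hab : ∀ n, a n = b n) {L : ℝ}
    (h : Tendsto (fun n : ℕ => Real.log (b n) / n) atTop (𝓝 L)) :
    Tendsto (fun n : ℕ => 1 / (n : ℝ) * Real.logb q (a n)) atTop (𝓝 (L / Real.log q)) := by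
  refine (h.div_const (Real.log q)).congr fun n => ?_
  rw [hab, Real.logb]
  ring

theorem tendsto_logb_leeSphereSize {q : ℕ} [NeZero q] {t : ℕ → ℕ} {T ρ : ℝ}
    (ht : Tendsto (fun n : ℕ => (t n : ℝ) / (n : ℝ)) atTop (𝓝 T)) (hT : 0 < T)
    (hTM : T < (q / 2 : ℕ)) (hρ : 0 < ρ) (h : saddleFun (leeWeight (m := q)) T ρ = 0) :
    Tendsto (fun n : ℕ => 1 / (n : ℝ) * Real.logb q (leeSphereSize n (t n) q : ℝ)) atTop
      (𝓝 (Real.logb q (enumerator (leeWeight (m := q)) ρ) - T * Real.logb q ρ)) := by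
  convert tendsto_logb_of_tendsto_log (q := q) (fun n => leeSphereSize_eq n (t n))
    (tendsto_log_sphereCount leeWeight_le exists_leeWeight_eq ht hT hTM hρ h) using 2
  simp only [Real.logb]; ring

theorem tendsto_logb_leeBallSize {q : ℕ} [NeZero q] {t : ℕ → ℕ} {T ρ : ℝ}
    (ht : Tendsto (fun n : ℕ => (t n : ℝ) / (n : ℝ)) atTop (𝓝 T)) (hT : 0 < T)
    (hTM : T < (q / 2 : ℕ)) (hρ : 0 < ρ) (h : saddleFun (leeWeight (m := q)) T ρ = 0)
    (hmean : 0 < ∑ x : ZMod q, ((leeWeight x : ℝ) - T)) :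
    Tendsto (fun n : ℕ => 1 / (n : ℝ) * Real.logb q (leeBallSize n (t n) q : ℝ)) atTop
      (𝓝 (Real.logb q (enumerator (leeWeight (m := q)) ρ) - T * Real.logb q ρ)) := by
  convert tendsto_logb_of_tendsto_log (q := q) (fun n => leeBallSize_eq n (t n))
    (tendsto_log_ballCount leeWeight_le exists_leeWeight_eq ht hT hTM hρ h hmean) using 2
  simp only [Real.logb]; ring

theorem tendsto_logb_lee_zero {q : ℕ} (hq : 0 < q / 2) {t : ℕ → ℕ}
    (ht : Tendsto (fun n : ℕ => (t n : ℝ) / (n : ℝ)) atTop (𝓝 0)) :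
    Tendsto (fun n : ℕ => 1 / (n : ℝ) * Real.logb q (leeSphereSize n (t n) q : ℝ)) atTop (𝓝 0) ∧
    Tendsto (fun n : ℕ => 1 / (n : ℝ) * Real.logb q (leeBallSize n (t n) q : ℝ)) atTop (𝓝 0) := by
  have : NeZero q := ⟨by omega⟩
  obtain ⟨hs, hb⟩ := tendsto_log_count_zero hq exists_leeWeight_eq
    (existsUnique_leeWeight_eq_zero (m := q)) ht
  constructor
  · simpa using tendsto_logb_of_tendsto_log (q := q) (fun n => leeSphereSize_eq n (t n)) hs
  · simpa using tendsto_logb_of_tendsto_log (q := q) (fun n => leeBallSize_eq n (t n)) hb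

theorem lemma5p3 (q M : ℕ) (hM : M = q / 2) (t : ℕ → ℕ) (T : ℝ)
    (ht : Tendsto (fun n : ℕ => (t n : ℝ) / (n : ℝ)) atTop (𝓝 T))
    (hT0 : 0 ≤ T) (hTM : T < (M : ℝ)) :
    -- odd modulus
    (Odd q →
      (0 < T →
        (∃! ρ : ℝ, 0 < ρ ∧ IsLeeSaddleOdd M T ρ) ∧
        ∀ ρ : ℝ, 0 < ρ → IsLeeSaddleOdd M T ρ →
          leeGenOdd M ρ = ((M : ℝ) * (ρ + 1) + 1) / ((1 - ρ) * ((M : ℝ) - T) + 1) ∧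
          Tendsto (fun n : ℕ => 1 / (n : ℝ) * Real.logb q (leeSphereSize n (t n) q : ℝ)) atTop
            (𝓝 (Real.logb q (leeGenOdd M ρ) - T * Real.logb q ρ)) ∧
          (T < (M : ℝ) * ((M : ℝ) + 1) / (2 * (M : ℝ) + 1) →
            Tendsto (fun n : ℕ => 1 / (n : ℝ) * Real.logb q (leeBallSize n (t n) q : ℝ)) atTop
              (𝓝 (Real.logb q (leeGenOdd M ρ) - T * Real.logb q ρ)))) ∧
      -- for `T = 0` the root is `ρ = 0`, `f(0) = 1`, `0 log 0 = 0`, and the value is `0`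
      (T = 0 →
        Tendsto (fun n : ℕ => 1 / (n : ℝ) * Real.logb q (leeSphereSize n (t n) q : ℝ)) atTop
          (𝓝 0) ∧
        Tendsto (fun n : ℕ => 1 / (n : ℝ) * Real.logb q (leeBallSize n (t n) q : ℝ)) atTop
          (𝓝 0))) ∧
    -- even modulus
    (Even q →
      (0 < T →
        (∃! ρ : ℝ, 0 < ρ ∧ IsLeeSaddleEven M T ρ) ∧
        ∀ ρ : ℝ, 0 < ρ → IsLeeSaddleEven M T ρ →
          ((1 - ρ) * ((M : ℝ) - T) + 1) * leeGenEven M ρ = (M : ℝ) * (ρ + 1) + 1 - ρ ^ M ∧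
          Tendsto (fun n : ℕ => 1 / (n : ℝ) * Real.logb q (leeSphereSize n (t n) q : ℝ)) atTop
            (𝓝 (Real.logb q (leeGenEven M ρ) - T * Real.logb q ρ)) ∧
          (T < (M : ℝ) / 2 →
            Tendsto (fun n : ℕ => 1 / (n : ℝ) * Real.logb q (leeBallSize n (t n) q : ℝ)) atTop
              (𝓝 (Real.logb q (leeGenEven M ρ) - T * Real.logb q ρ)))) ∧
      (T = 0 →
        Tendsto (fun n : ℕ => 1 / (n : ℝ) * Real.logb q (leeSphereSize n (t n) q : ℝ)) atTop
          (𝓝 0) ∧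
        Tendsto (fun n : ℕ => 1 / (n : ℝ) * Real.logb q (leeBallSize n (t n) q : ℝ)) atTop
          (𝓝 0))) := by
  have hMpos : 0 < q / 2 := by
    have : (0 : ℝ) < M := hT0.trans_lt hTM
    rw [← hM]; exact_mod_cast this
  refine ⟨fun hodd => ⟨fun hT => ?_, fun h => tendsto_logb_lee_zero hMpos (h ▸ ht)⟩,
    fun heven => ⟨fun hT => ?_, fun h => tendsto_logb_lee_zero hMpos (h ▸ ht)⟩⟩
  · obtain rfl : q = 2 * M + 1 := by obtain ⟨r, rfl⟩ := hodd; omega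
    have hTM' : T < ((2 * M + 1) / 2 : ℕ) := by rwa [← hM]
    simp only [isLeeSaddleOdd_iff]
    refine ⟨existsUnique_saddle leeWeight_le exists_leeWeight_eq hT hTM', fun ρ hρ h => ?_⟩
    rw [← enumerator_lee_odd]
    refine ⟨?_, tendsto_logb_leeSphereSize ht hT hTM' hρ h, fun hT1 =>
      tendsto_logb_leeBallSize ht hT hTM' hρ h (sum_leeWeight_sub_odd_pos hT1)⟩
    rw [enumerator_lee_odd]
    exact leeGenOdd_eq_div hρ ((isLeeSaddleOdd_iff M T ρ).2 h)
  · obtain rfl : q = 2 * M := by obtain ⟨r, rfl⟩ := heven; omega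
    have hM1 : 1 ≤ M := by omega
    have : NeZero (2 * M) := ⟨by omega⟩
    have hTM' : T < ((2 * M) / 2 : ℕ) := by rwa [← hM]
    simp only [isLeeSaddleEven_iff]
    refine ⟨existsUnique_saddle leeWeight_le exists_leeWeight_eq hT hTM', fun ρ hρ h => ?_⟩
    rw [← enumerator_lee_even]
    refine ⟨?_, tendsto_logb_leeSphereSize ht hT hTM' hρ h, fun hT1 =>
      tendsto_logb_leeBallSize ht hT hTM' hρ h (sum_leeWeight_sub_even_pos hT1)⟩
    rw [enumerator_lee_even]
    exact mul_leeGenEven_eq hM1 ((isLeeSaddleEven_iff M T ρ).2 h)
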